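/- **Setting.** A fading MIMO broadcast channel has $L$ users, $M$ transmit antennas and $N_l$ antennas at user $l$. User $l$ observes $(Y_l,H_l)$, where $Y_l=H_lX+Z_l$, $X$ is the $\mathbb{R}^M$-valued transmitted signal, $H_l$ is a random $N_l\times M$ real matrix with a given law and $\mathrm{E}\,\mathrm{tr}(H_lH_l^T)<\infty$, and $Z_l\sim\mathcal N(0,I)$; the signals and all the $H_l$, $Z_l$ are independent of each other. The transmitter is subject to $\mathrm{E}\,\mathrm{tr}(XX^T)\le P$. An *assignment* consists of an encoding order of the users (say $1,\dots,L$ after relabelling), zero-mean jointly Gaussian $\mathbb{R}^M$-valued user signals $X_1,\dots,X_L$, and $M\times M$ real matrices $F_1,\dots,F_L$. With the interference $S_l=\sum_{i<l}X_i$, each signal $X_l$ is generated from a conditional distribution given $S_l$, i.e. the Markov relation $(X_1,\dots,X_{l-1})\leftrightarrow S_l\leftrightarrow X_l$ holds; $X_l$ and $S_l$ may be dependent. The transmitted signal is $X=\sum_lX_l$. With $U_l=F_lS_l+X_l$, the rate of user $l$ is $R_l=I(U_l;Y_l,H_l)-I(U_l;S_l)$ (equal to $-\infty$ if $I(U_l;S_l)=\infty$).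 The *linear-assignment fading-paper (LAFP) achievable region* is the convex hull of the union, over all orders and all assignments that satisfy the power constraint, of the sets of rate tuples $(r_1,\dots,r_L)$ with $0\le r_l\le R_l$ for all $l$. **Theorem.** The LAFP achievable region is exhausted by assignments in which every $X_l$ is independent of its interference $S_l$: restricting the union to these assignments gives the same region. More precisely, for every assignment $(X_l),(F_l)$ there are, on the same probability space and for the same encoding order, an assignment $(\hat X_l),(\hat F_l)$ whose signals $\hat X_1,\dots,\hat X_L$ are mutually independent (in particular $\hat X_l$ is independent of $\hat S_l=\sum_{i<l}\hat X_i$), with the same total transmitted signal $\sum_l\hat X_l=\sum_lX_l$, such that $\hat R_l\ge R_l$ for every user $l$. -/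

import Mathlib

open MeasureTheory ProbabilityTheory
open scoped ENNReal

/-- The product (equivalently Borel) sigma-algebra on real matrices. -/
instance matrixMeasurableSpace {m n : Type*} : MeasurableSpace (Matrix m n ℝ) :=
  inferInstanceAs (MeasurableSpace (m → n → ℝ))

namespace FadingBC

/-- Real column vectors, with the Euclidean norm. -/
abbrev Vec (n : ℕ) := EuclideanSpace ℝ (Fin n)

section Information

variable {Ω α β γ : Type*} [MeasurableSpace Ω] [MeasurableSpace α] [MeasurableSpace β]
  [MeasurableSpace γ]

/-- The mutual information `I(A;B)`, in nats, with values in `[0,∞]`: the relative entropy of the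
joint law with respect to the product of the marginal laws. -/
noncomputable def mutualInfo (P : Measure Ω) (A : Ω → α) (B : Ω → β) : ℝ≥0∞ :=
  InformationTheory.klDiv (P.map fun ω => (A ω, B ω)) ((P.map A).prod (P.map B))

/-- The Markov relation `A ↔ B ↔ C`: given `(A, B)`, the variable `C` is distributed according to a
transition probability `Pr[c | b]` that depends on `B` only. -/
def IsMarkovChain (P : Measure Ω) (A : Ω → α) (B : Ω → β) (C : Ω → γ) : Prop :=
  ∃ κ : Kernel β γ, IsMarkovKernel κ ∧
    HasCondDistrib C (fun ω => (A ω, B ω))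
      (κ.comap Prod.snd (measurable_snd : Measurable (Prod.snd : α × β → β))) P

end Information

/-- A fading MIMO broadcast channel with `L` users, `M` transmit antennas and `N l` antennas at
user `l`: the law of the random `N l × M` channel matrix of each user, of finite energy
`E tr(H Hᵀ)`. -/
structure Channel (L M : ℕ) (N : Fin L → ℕ) where
  fade : ∀ l, Measure (Matrix (Fin (N l)) (Fin M) ℝ)
  isProbabilityMeasure_fade : ∀ l, IsProbabilityMeasure (fade l)
  finite_energy : ∀ l, Integrable (fun h => (h * h.transpose).trace) (fade l)

section Signals

variable {L M : ℕ} {Ω : Type*} [MeasurableSpace Ω]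

/-- The interference `S_l`: the sum of the signals of the users encoded before user `l`. User `i`
is encoded at position `π i`. -/
noncomputable def interference (π : Equiv.Perm (Fin L)) (X : Fin L → Ω → Vec M) (l : Fin L)
    (ω : Ω) : Vec M :=
  ∑ i : {i // π i < π l}, X i ω

/-- The transmitted signal `X_1 + ... + X_L`. -/
noncomputable def total (X : Fin L → Ω → Vec M) (ω : Ω) : Vec M := ∑ l, X l ω

/-- The auxiliary variable `U_l = F_l S_l + X_l` of a linear assignment. -/
noncomputable def aux (π : Equiv.Perm (Fin L)) (X : Fin L → Ω → Vec M)
    (F : Fin L → Matrix (Fin M) (Fin M) ℝ) (l : Fin L) (ω : Ω) : Vec M :=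
  (F l).toEuclideanLin (interference π X l ω) + X l ω

/-- Zero-mean, jointly Gaussian user signals, generated successively in the order `π`, the signal of
each user being drawn given its interference: the earlier signals influence `X_l` only through
their sum `S_l`. No independence of `X_l` and `S_l` is required. -/
structure IsGaussianAssignment (π : Equiv.Perm (Fin L)) (P : Measure Ω) (X : Fin L → Ω → Vec M) :
    Prop where
  measurable : ∀ l, Measurable (X l)
  gaussian : HasGaussianLaw (fun ω l => X l ω) P
  zero_mean : ∀ l, ∫ ω, X l ω ∂P = 0
  markov : ∀ l, IsMarkovChain P (fun ω (i : {i // π i < π l}) => X i ω) (interference π X l) (X l)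

end Signals

namespace Channel

variable {L M : ℕ} {N : Fin L → ℕ} (W : Channel L M N)

/-- Sample space of one channel use: signals, channel matrices and noises. -/
abbrev UseSpace (N : Fin L → ℕ) (M : ℕ) (Ω : Type*) :=
  Ω × (∀ l, Matrix (Fin (N l)) (Fin M) ℝ) × (∀ l, Vec (N l))

section

variable {Ω : Type*} [MeasurableSpace Ω]

/-- The law of one channel use: the channel matrices and the standard Gaussian noises (zero mean,
identity covariance) of all users are independent of each other and of the signals. -/
noncomputable def joint (P : Measure Ω) : Measure (UseSpace N M Ω) :=
  P.prod ((Measure.pi W.fade).prod (Measure.pi fun l => stdGaussian (Vec (N l))))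

/-- The output `(Y_l, H_l)` of user `l`, where `Y_l = H_l (X_1 + ... + X_L) + Z_l`. -/
noncomputable def output (X : Fin L → Ω → Vec M) (l : Fin L) (w : UseSpace N M Ω) :
    Vec (N l) × Matrix (Fin (N l)) (Fin M) ℝ :=
  ((w.2.1 l).toEuclideanLin (total X w.1) + w.2.2 l, w.2.1 l)

/-- The rate `I(U_l; Y_l, H_l) - I(U_l; S_l)` of user `l`. The first term is finite because of the
finite energy of the channel; the rate is `-∞` where the second one is infinite. -/
noncomputable def rate (P : Measure Ω) (π : Equiv.Perm (Fin L)) (X : Fin L → Ω → Vec M)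
    (F : Fin L → Matrix (Fin M) (Fin M) ℝ) (l : Fin L) : EReal :=
  ((mutualInfo (W.joint P) (fun w => aux π X F l w.1) (output X l) : ℝ≥0∞) : EReal) -
    ((mutualInfo P (aux π X F l) (interference π X l) : ℝ≥0∞) : EReal)

/-- The tuples of nonnegative rates that a given assignment supports. -/
def assignmentRegion (P : Measure Ω) (π : Equiv.Perm (Fin L)) (X : Fin L → Ω → Vec M)
    (F : Fin L → Matrix (Fin M) (Fin M) ℝ) : Set (Fin L → ℝ) :=
  {R | ∀ l, 0 ≤ R l ∧ (R l : EReal) ≤ W.rate P π X F l}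

end

/-- The LAFP achievable region under the power constraint `E tr(X Xᵀ) = E ‖X‖² ≤ p`: the convex hull
of the union, over all encoding orders, Gaussian assignments and matrices `F_l`, of the rate
regions of the assignments. -/
def lafpRegion (p : ℝ) : Set (Fin L → ℝ) :=
  convexHull ℝ {R | ∃ (Ω : Type) (_ : MeasurableSpace Ω) (P : Measure Ω)
    (_ : IsProbabilityMeasure P) (π : Equiv.Perm (Fin L)) (X : Fin L → Ω → Vec M)
    (F : Fin L → Matrix (Fin M) (Fin M) ℝ),
    IsGaussianAssignment π P X ∧ ∫ ω, ‖total X ω‖ ^ 2 ∂P ≤ p ∧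
      R ∈ W.assignmentRegion P π X F}

/-- The part of the LAFP region obtained when each `X_l` is independent of its interference. -/
def lafpRegionIndep (p : ℝ) : Set (Fin L → ℝ) :=
  convexHull ℝ {R | ∃ (Ω : Type) (_ : MeasurableSpace Ω) (P : Measure Ω)
    (_ : IsProbabilityMeasure P) (π : Equiv.Perm (Fin L)) (X : Fin L → Ω → Vec M)
    (F : Fin L → Matrix (Fin M) (Fin M) ℝ),
    IsGaussianAssignment π P X ∧ (∀ l, IndepFun (X l) (interference π X l) P) ∧
      ∫ ω, ‖total X ω‖ ^ 2 ∂P ≤ p ∧ R ∈ W.assignmentRegion P π X F}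

end Channel

end FadingBC

/-! Linear regression splits each signal as `X_l = D_l S_l + R_l`. By Gaussianity the residual `R_l`
is independent of `S_l`, and by the Markov relation of all earlier signals, so the residuals are
mutually independent. Writing `S_{k+1} = (1 + D_k) S_k + R_k` with users numbered by position, put
`B_L = 1` and `B_k = B_{k+1} (1 + D_k)`. The signals `B_{l+1} R_l` are then independent, have
partial sums `B_l S_l`, and keep the total (`exists_transform_sum_eq`).

It remains to compare rates. With `G = F_l + D_l` one has `U = G S + R`, while the output `V` is a
function of `B R + E S` and independent noise, where `B = B_{l+1}` and `E = B_l`; the later signals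
belong to the noise. The new interference `s = E S` may lose information, since `E` can be singular.
Regressing `S` on `s` leaves `q = S - K s`, independent of `s`, `R` and the noise. For `U₁ = U - G q
= G K s + R`, `I(U;V) ≤ I(U;q) + I(U₁;V)` and `I(U;S) ≥ I(U;q) + I(U₁;s)`. Replacing `U₁` by `B U₁`
costs `I(U₁;V|BU₁)` in the first term of the rate and saves `I(U₁;s|BU₁)` in the second. Data
processing bounds the cost by the saving, because `V` is computed from `B U₁`, `s` and noise. Since
`B U₁ = (B G K) s + B R`, the new matrix is `B G K`. This is `exists_mutualInfo_assignment_le`,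
resting on `exists_mutualInfo_le_add`. Information may be infinite, so the inequalities share an
explicit slack instead of being subtracted. -/

namespace FadingBC

/-! ### Mutual information: data processing and chain rules in `[0,∞]`. -/

section InformationInequalities

open InformationTheory

instance {m n : Type*} [Countable m] [Countable n] : StandardBorelSpace (Matrix m n ℝ) :=
  inferInstanceAs (StandardBorelSpace (m → n → ℝ))

variable {Ω α β γ δ : Type*} [MeasurableSpace Ω] [MeasurableSpace α] [MeasurableSpace β]
  [MeasurableSpace γ] [MeasurableSpace δ] {P : Measure Ω} [IsProbabilityMeasure P]

/-- Data processing for mutual information under deterministic maps of both variables. -/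
lemma mutualInfo_comp_le {A : Ω → α} {B : Ω → β} (hA : Measurable A) (hB : Measurable B)
    {f : α → γ} {g : β → δ} (hf : Measurable f) (hg : Measurable g) :
    mutualInfo P (fun ω => f (A ω)) (fun ω => g (B ω)) ≤ mutualInfo P A B := by
  have := Measure.isProbabilityMeasure_map (μ := P) hA.aemeasurable
  have := Measure.isProbabilityMeasure_map (μ := P) hB.aemeasurable
  have h := klDiv_map_le (P.map fun ω => (A ω, B ω)) ((P.map A).prod (P.map B))
    (g := Prod.map f g) (by fun_prop)
  rw [Measure.map_map (by fun_prop) (by fun_prop), ← Measure.map_prod_map _ _ hf hg,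
    Measure.map_map hf hA, Measure.map_map hg hB] at h
  exact h

lemma mutualInfo_map {μ : Measure Ω} {T : Ω → δ} (hT : Measurable T) {A : δ → α} {B : δ → β}
    (hA : Measurable A) (hB : Measurable B) :
    mutualInfo μ (fun ω => A (T ω)) (fun ω => B (T ω)) = mutualInfo (μ.map T) A B := by
  unfold mutualInfo
  rw [Measure.map_map (by fun_prop) hT, Measure.map_map hA hT, Measure.map_map hB hT]
  rfl

/-- The relative entropy to a product measure splits off the mutual information. -/
lemma klDiv_map_prodMk_prod [StandardBorelSpace β] [Nonempty β] {A : Ω → α} {B : Ω → β}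
    (hA : Measurable A) (hB : Measurable B) (Q : Measure α) [IsProbabilityMeasure Q] :
    klDiv (P.map fun ω => (A ω, B ω)) (Q.prod (P.map B)) =
      klDiv (P.map A) Q + mutualInfo P A B := by
  have := Measure.isProbabilityMeasure_map (μ := P) hA.aemeasurable
  have := Measure.isProbabilityMeasure_map (μ := P) hB.aemeasurable
  -- Disintegrate the joint law over `A` and view `Q.prod (P.map B)` as a constant kernel over `Q`;
  -- the conditional term of the chain rule is then `I(A;B)`.
  rw [mutualInfo, ← compProd_map_condDistrib hB.aemeasurable, ← Measure.compProd_const,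
    klDiv_compProd_eq_add, Measure.compProd_const]

/-- Chain rule for the mutual information with a pair of independent variables. -/
lemma mutualInfo_prodMk_of_indepFun [StandardBorelSpace γ] [Nonempty γ] {A : Ω → α} {B : Ω → β}
    {C : Ω → γ} (hA : Measurable A) (hB : Measurable B) (hC : Measurable C)
    (hBC : IndepFun B C P) :
    mutualInfo P A (fun ω => (B ω, C ω)) =
      mutualInfo P A B + mutualInfo P (fun ω => (A ω, B ω)) C := by
  have := Measure.isProbabilityMeasure_map (μ := P) hA.aemeasurable
  have := Measure.isProbabilityMeasure_map (μ := P) hB.aemeasurable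
  have := Measure.isProbabilityMeasure_map (μ := P) hC.aemeasurable
  have h := klDiv_map_prodMk_prod (P := P) (hA.prodMk hB) hC ((P.map A).prod (P.map B))
  rw [show klDiv (P.map fun ω => (A ω, B ω)) ((P.map A).prod (P.map B)) = mutualInfo P A B
    from rfl] at h
  rw [← h, mutualInfo, (indepFun_iff_map_prod_eq_prod_map_map hB.aemeasurable hC.aemeasurable).1 hBC,
    ← Measure.prodAssoc_prod]
  have e : (P.map fun ω => (A ω, B ω, C ω)) =
      (P.map fun ω => ((A ω, B ω), C ω)).map MeasurableEquiv.prodAssoc := by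
    rw [Measure.map_map (by fun_prop) (by fun_prop)]; rfl
  rw [e]
  refine le_antisymm (klDiv_map_le _ _ (by fun_prop)) ?_
  have h' := klDiv_map_le ((P.map fun ω => ((A ω, B ω), C ω)).map MeasurableEquiv.prodAssoc)
    ((((P.map A).prod (P.map B)).prod (P.map C)).map MeasurableEquiv.prodAssoc)
    (g := MeasurableEquiv.prodAssoc.symm) (by fun_prop)
  rwa [MeasurableEquiv.map_symm_map, MeasurableEquiv.map_symm_map] at h'

/-- Adjoining an independent variable does not change the mutual information. -/
lemma mutualInfo_prodMk_le_of_indepFun {A : Ω → α} {B : Ω → β} {C : Ω → γ} (hA : Measurable A)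
    (hB : Measurable B) (hC : Measurable C) (h : IndepFun B (fun ω => (A ω, C ω)) P) :
    mutualInfo P (fun ω => (A ω, B ω)) C ≤ mutualInfo P A C := by
  have := Measure.isProbabilityMeasure_map (μ := P) hA.aemeasurable
  have := Measure.isProbabilityMeasure_map (μ := P) hB.aemeasurable
  have := Measure.isProbabilityMeasure_map (μ := P) hC.aemeasurable
  have hAB : IndepFun A B P := (h.comp measurable_id measurable_fst).symm
  -- Joint law and product law are images, under one rearrangement, of products with the same factor
  -- `P.map B`, which cancels in the relative entropy.
  have h₁ : (P.map fun ω => ((A ω, B ω), C ω)) =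
      ((P.map fun ω => (A ω, C ω)).prod (P.map B)).map (fun x => ((x.1.1, x.2), x.1.2)) := by
    rw [← (indepFun_iff_map_prod_eq_prod_map_map (by fun_prop) hB.aemeasurable).1 h.symm,
      Measure.map_map (by fun_prop) (by fun_prop)]
    rfl
  have h₂ : ((P.map fun ω => (A ω, B ω)).prod (P.map C)) =
      (((P.map A).prod (P.map C)).prod (P.map B)).map (fun x => ((x.1.1, x.2), x.1.2)) := by
    rw [(indepFun_iff_map_prod_eq_prod_map_map hA.aemeasurable hB.aemeasurable).1 hAB]
    refine Measure.ext_of_lintegral _ fun f hf => ?_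
    rw [lintegral_map hf (by fun_prop), lintegral_prod _ (by fun_prop),
      lintegral_prod _ (by fun_prop), lintegral_prod _ (by fun_prop),
      lintegral_prod _ (by fun_prop)]
    refine lintegral_congr fun a => ?_
    exact lintegral_lintegral_swap (f := fun b c => f ((a, b), c)) (by fun_prop)
  rw [mutualInfo, h₁, h₂]
  refine (klDiv_map_le _ _ (by fun_prop)).trans ?_
  rw [← Measure.compProd_const, ← Measure.compProd_const, klDiv_compProd_left]
  rfl

/-- Chain rule for `I(U;Y)` along a function `b U` of `U`. -/
lemma mutualInfo_eq_add_klDiv [StandardBorelSpace α] [Nonempty α] {U : Ω → α} {Y : Ω → γ}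
    {b : α → β} (hU : Measurable U) (hY : Measurable Y) (hb : Measurable b) :
    mutualInfo P U Y = mutualInfo P (fun ω => b (U ω)) Y +
      klDiv (P.map fun ω => ((b (U ω), Y ω), U ω))
        ((P.map fun ω => (b (U ω), Y ω)) ⊗ₘ
          (condDistrib U (fun ω => b (U ω)) P).comap Prod.fst measurable_fst) := by
  have := Measure.isProbabilityMeasure_map (μ := P) hU.aemeasurable
  have := Measure.isProbabilityMeasure_map (μ := P) hY.aemeasurable
  have hbU : Measurable fun ω => b (U ω) := hb.comp hU
  have := Measure.isProbabilityMeasure_map (μ := P) hbU.aemeasurable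
  have := Measure.isProbabilityMeasure_map (μ := P) (hbU.prodMk hY).aemeasurable
  -- Under the product of the laws of `U` and `Y`, the conditional law of `U` given `(b U, Y)` is
  -- still `κ`, so the second term of the chain rule is `I(U;Y|bU)`.
  set κ := condDistrib U (fun ω => b (U ω)) P with hκ
  have hc := klDiv_compProd_eq_add (P.map fun ω => (b (U ω), Y ω))
    ((P.map fun ω => b (U ω)).prod (P.map Y)) (condDistrib U (fun ω => (b (U ω), Y ω)) P)
    (κ.comap Prod.fst measurable_fst)
  rw [compProd_map_condDistrib hU.aemeasurable] at hc
  rw [mutualInfo, mutualInfo, ← hc]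
  have h₁ : (P.map fun ω => ((b (U ω), Y ω), U ω)) =
      (P.map fun ω => (U ω, Y ω)).map (fun x => ((b x.1, x.2), x.1)) := by
    rw [Measure.map_map (by fun_prop) (by fun_prop)]; rfl
  have h₂ : ((P.map fun ω => b (U ω)).prod (P.map Y)) ⊗ₘ κ.comap Prod.fst measurable_fst =
      ((P.map U).prod (P.map Y)).map (fun x => ((b x.1, x.2), x.1)) := by
    have e : (P.map U).map (fun u => (b u, u)) = (P.map fun ω => b (U ω)) ⊗ₘ κ := by
      rw [hκ, compProd_map_condDistrib hU.aemeasurable, Measure.map_map (by fun_prop) hU]; rfl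
    refine Measure.ext_of_lintegral _ fun f hf => ?_
    rw [lintegral_map hf (by fun_prop), lintegral_prod _ (by fun_prop),
      Measure.lintegral_compProd hf,
      lintegral_prod _ (Measurable.lintegral_kernel_prod_right' hf).aemeasurable]
    have e' : ∫⁻ u, ∫⁻ y, f ((b u, y), u) ∂(P.map Y) ∂(P.map U) =
        ∫⁻ x, ∫⁻ y, f ((x.1, y), x.2) ∂(P.map Y) ∂((P.map U).map (fun u => (b u, u))) := by
      exact (lintegral_map (f := fun x : β × α => ∫⁻ y, f ((x.1, y), x.2) ∂(P.map Y))
        (g := fun u => (b u, u)) (by fun_prop) (by fun_prop)).symm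
    rw [e', e, Measure.lintegral_compProd
      (f := fun x : β × α => ∫⁻ y, f ((x.1, y), x.2) ∂(P.map Y)) (by fun_prop)]
    refine lintegral_congr fun a => ?_
    exact lintegral_lintegral_swap (μ := P.map Y) (ν := κ a) (f := fun y u => f ((a, y), u))
      (by fun_prop)
  rw [h₁, h₂]
  -- The map `(u, y) ↦ ((b u, y), u)` has a measurable left inverse, so data processing in both
  -- directions gives equality.
  refine le_antisymm ?_ (klDiv_map_le _ _ (by fun_prop))
  have h' := klDiv_map_le ((P.map fun ω => (U ω, Y ω)).map (fun x => ((b x.1, x.2), x.1)))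
    (((P.map U).prod (P.map Y)).map (fun x => ((b x.1, x.2), x.1)))
    (g := fun x : (β × γ) × α => (x.2, x.1.2)) (by fun_prop)
  rw [Measure.map_map (μ := P.map fun ω => (U ω, Y ω)) (by fun_prop) (by fun_prop),
    Measure.map_map (μ := (P.map U).prod (P.map Y)) (by fun_prop) (by fun_prop)] at h'
  simpa [Function.comp_def] using h'

/-- If `V` is a function of `b U`, `S` and noise independent of `(U, S)`, then `U` brings no more
additional information about `V` than about `S`, compared with `b U`. -/
lemma exists_mutualInfo_le_add [StandardBorelSpace α] [Nonempty α] {U : Ω → α} {S : Ω → γ}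
    {n : Ω → δ} {ε : Type*} [MeasurableSpace ε] {b : α → β} {g : (β × γ) × δ → ε}
    (hU : Measurable U) (hS : Measurable S) (hn : Measurable n) (hb : Measurable b)
    (hg : Measurable g) (hind : IndepFun (fun ω => (U ω, S ω)) n P) :
    ∃ d : ℝ≥0∞,
      mutualInfo P U (fun ω => g ((b (U ω), S ω), n ω)) ≤
        mutualInfo P (fun ω => b (U ω)) (fun ω => g ((b (U ω), S ω), n ω)) + d ∧
      mutualInfo P (fun ω => b (U ω)) S + d = mutualInfo P U S := by
  -- The slack is `I(U;S|bU)`; what remains is `I(U;V|bU) ≤ I(U;S|bU)` for `V = g((bU, S), n)`.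
  refine ⟨_, ?_, (mutualInfo_eq_add_klDiv hU hS hb).symm⟩
  have hbU : Measurable fun ω => b (U ω) := hb.comp hU
  have hV : Measurable fun ω => g ((b (U ω), S ω), n ω) := by fun_prop
  have := Measure.isProbabilityMeasure_map (μ := P) hn.aemeasurable
  have := Measure.isProbabilityMeasure_map (μ := P) (hbU.prodMk hS).aemeasurable
  have := Measure.isProbabilityMeasure_map (μ := P)
    (((hbU.prodMk hS).prodMk hU).aemeasurable (μ := P))
  rw [mutualInfo_eq_add_klDiv hU hV hb]
  refine add_le_add le_rfl ?_
  set κ := condDistrib U (fun ω => b (U ω)) P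
  -- Both laws defining `I(U;V|bU)` arise from those defining `I(U;S|bU)` by adjoining `n` and
  -- applying one map. This map keeps `b U`, on which alone `κ` depends.
  have h₁ : (P.map fun ω => ((b (U ω), g ((b (U ω), S ω), n ω)), U ω)) =
      ((P.map fun ω => ((b (U ω), S ω), U ω)).prod (P.map n)).map
        (fun x => ((x.1.1.1, g (x.1.1, x.2)), x.1.2)) := by
    have hi : IndepFun (fun ω => ((b (U ω), S ω), U ω)) n P :=
      hind.comp (φ := fun x : α × γ => ((b x.1, x.2), x.1)) (by fun_prop) measurable_id
    rw [← (indepFun_iff_map_prod_eq_prod_map_map (by fun_prop) hn.aemeasurable).1 hi,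
      Measure.map_map (by fun_prop) (by fun_prop)]
    rfl
  have h₂ : (P.map fun ω => (b (U ω), g ((b (U ω), S ω), n ω))) ⊗ₘ
        κ.comap Prod.fst measurable_fst =
      (((P.map fun ω => (b (U ω), S ω)) ⊗ₘ κ.comap Prod.fst measurable_fst).prod
        (P.map n)).map (fun x => ((x.1.1.1, g (x.1.1, x.2)), x.1.2)) := by
    have hi : IndepFun (fun ω => (b (U ω), S ω)) n P :=
      hind.comp (φ := fun x : α × γ => (b x.1, x.2)) (by fun_prop) measurable_id
    have e : (P.map fun ω => (b (U ω), g ((b (U ω), S ω), n ω))) =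
        ((P.map fun ω => (b (U ω), S ω)).prod (P.map n)).map
          (fun x => (x.1.1, g (x.1, x.2))) := by
      rw [← (indepFun_iff_map_prod_eq_prod_map_map (by fun_prop) hn.aemeasurable).1 hi,
        Measure.map_map (by fun_prop) (by fun_prop)]
      rfl
    have := Measure.isProbabilityMeasure_map (μ := P) (hbU.prodMk hV).aemeasurable
    refine Measure.ext_of_lintegral _ fun f hf => ?_
    have hm := Measurable.lintegral_kernel_prod_right' (κ := κ.comap Prod.fst measurable_fst) hf
    have hr : Measurable fun x : (β × γ) × δ => (x.1.1, g (x.1, x.2)) := by fun_prop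
    have hp := lintegral_prod (μ := P.map fun ω => (b (U ω), S ω)) (ν := P.map n) _
      (hm.comp hr).aemeasurable
    rw [Measure.lintegral_compProd hf, e, lintegral_map hm hr, lintegral_map hf (by fun_prop)]
    refine hp.trans ?_
    rw [lintegral_prod _ (by fun_prop), Measure.lintegral_compProd
      (f := fun x : (β × γ) × α => ∫⁻ m, f ((x.1.1, g (x.1, m)), x.2) ∂(P.map n)) (by fun_prop)]
    refine lintegral_congr fun a => ?_
    exact lintegral_lintegral_swap (μ := P.map n) (ν := κ a.1)
      (f := fun m u => f ((a.1, g (a, m)), u)) (by fun_prop)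
  rw [h₁, h₂]
  refine (klDiv_map_le _ _ (by fun_prop)).trans ?_
  rw [← Measure.compProd_const, ← Measure.compProd_const, klDiv_compProd_left]

/-- Passes from a shared slack to rates. If `s = ⊤` the left side is `⊥`, even for `a = ⊤`;
otherwise `s'` and `e` are finite, and the slack can be cancelled. -/
lemma ereal_sub_le_sub_of_add_le {a a' s s' e : ℝ≥0∞} (h : a ≤ a' + e) (h' : s' + e ≤ s) :
    ((a : EReal) - (s : EReal)) ≤ (a' : EReal) - (s' : EReal) := by
  by_cases hs : s = ⊤
  · simp [hs]
  have hs' : s' ≠ ⊤ := fun hh => hs (top_le_iff.1 (by simpa [hh] using h'))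
  have he : e ≠ ⊤ := fun hh => hs (top_le_iff.1 (by simpa [hh] using h'))
  by_cases ha' : a' = ⊤
  · lift s' to NNReal using hs'
    simp [ha']
  have ha : a ≠ ⊤ := fun hh => (ENNReal.add_ne_top.2 ⟨ha', he⟩) (top_le_iff.1 (by simpa [hh] using h))
  lift a to NNReal using ha
  lift a' to NNReal using ha'
  lift s to NNReal using hs
  lift s' to NNReal using hs'
  lift e to NNReal using he
  norm_cast at h h' ⊢
  have h1 : (a : ℝ) ≤ a' + e := by exact_mod_cast h
  have h2 : (s' : ℝ) + e ≤ s := by exact_mod_cast h'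
  have h3 : (a : ℝ) - s ≤ a' - s' := by linarith
  have := EReal.coe_le_coe_iff.2 h3
  simpa [EReal.coe_sub] using! this

end InformationInequalities

/-! ### Independence and Markov chains. -/

section Independence

variable {Ω α β γ δ : Type*} [MeasurableSpace Ω] [MeasurableSpace α] [MeasurableSpace β]
  [MeasurableSpace γ] [MeasurableSpace δ] {P : Measure Ω} [IsProbabilityMeasure P]

lemma indepFun_prodMk_right {A : Ω → α} {B : Ω → β} {C : Ω → γ} (hA : Measurable A)
    (hB : Measurable B) (hC : Measurable C) (h : IndepFun A B P)
    (h' : IndepFun (fun ω => (A ω, B ω)) C P) : IndepFun A (fun ω => (B ω, C ω)) P := by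
  have := Measure.isProbabilityMeasure_map (μ := P) hA.aemeasurable
  have := Measure.isProbabilityMeasure_map (μ := P) hB.aemeasurable
  have := Measure.isProbabilityMeasure_map (μ := P) hC.aemeasurable
  have hBC : IndepFun B C P := h'.comp measurable_snd measurable_id
  rw [indepFun_iff_map_prod_eq_prod_map_map hA.aemeasurable (by fun_prop),
    (indepFun_iff_map_prod_eq_prod_map_map hB.aemeasurable hC.aemeasurable).1 hBC,
    ← Measure.prodAssoc_prod,
    ← (indepFun_iff_map_prod_eq_prod_map_map hA.aemeasurable hB.aemeasurable).1 h,
    ← (indepFun_iff_map_prod_eq_prod_map_map (by fun_prop) hC.aemeasurable).1 h',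
    Measure.map_map (by fun_prop) (by fun_prop)]
  rfl

lemma indepFun_comp_iff_map {μ : Measure Ω} [IsProbabilityMeasure μ] {T : Ω → δ}
    (hT : Measurable T) {A : δ → α} {B : δ → β} (hA : Measurable A) (hB : Measurable B) :
    IndepFun (fun ω => A (T ω)) (fun ω => B (T ω)) μ ↔ IndepFun A B (μ.map T) := by
  have := Measure.isProbabilityMeasure_map (μ := μ) hT.aemeasurable
  rw [indepFun_iff_map_prod_eq_prod_map_map (by fun_prop) (by fun_prop),
    indepFun_iff_map_prod_eq_prod_map_map hA.aemeasurable hB.aemeasurable,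
    Measure.map_map (by fun_prop) hT, Measure.map_map hA hT, Measure.map_map hB hT]
  rfl

/-- Independent variables form a Markov chain through any intermediate variable. -/
lemma isMarkovChain_of_indepFun {A : Ω → α} {B : Ω → β} {C : Ω → γ} (hA : Measurable A)
    (hB : Measurable B) (hC : Measurable C) (h : IndepFun (fun ω => (A ω, B ω)) C P) :
    IsMarkovChain P A B C := by
  have := Measure.isProbabilityMeasure_map (μ := P) hC.aemeasurable
  refine ⟨Kernel.const β (P.map C), inferInstance, ?_⟩
  refine ⟨((hA.prodMk hB).prodMk hC).aemeasurable, ?_⟩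
  · rw [(indepFun_iff_map_prod_eq_prod_map_map (by fun_prop) hC.aemeasurable).1 h,
      ← Measure.compProd_const]
    rfl

/-- In a Markov chain `A ↔ B ↔ C`, a function of `(B, C)` that is independent of `B` is
independent of `(A, B)`. -/
lemma IsMarkovChain.indepFun [StandardBorelSpace δ] [Nonempty δ]
    {A : Ω → α} {B : Ω → β} {C : Ω → γ}
    (hA : Measurable A) (hB : Measurable B) (hC : Measurable C) (h : IsMarkovChain P A B C)
    {f : β × γ → δ} (hf : Measurable f) (hi : IndepFun (fun ω => f (B ω, C ω)) B P) :
    IndepFun (fun ω => f (B ω, C ω)) (fun ω => (A ω, B ω)) P := by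
  obtain ⟨κ, hκ, hd⟩ := h
  have hW : Measurable fun ω => f (B ω, C ω) := by fun_prop
  have := Measure.isProbabilityMeasure_map (μ := P) hB.aemeasurable
  have := Measure.isProbabilityMeasure_map (μ := P) (hA.prodMk hB).aemeasurable
  have := Measure.isProbabilityMeasure_map (μ := P) hW.aemeasurable
  -- The law of `f(b, C)` when `C` is drawn from `κ b`.
  let κ' : Kernel β δ := (Kernel.id ×ₖ κ).map f
  have hκ' : IsMarkovKernel κ' := Kernel.IsMarkovKernel.map _ hf
  have hl : ∀ (b : β) (g : δ → ℝ≥0∞), Measurable g →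
      ∫⁻ w, g w ∂(κ' b) = ∫⁻ c, g (f (b, c)) ∂(κ b) := fun b g hg => by
    simp only [κ']
    rw [Kernel.lintegral_map _ hf _ hg, Kernel.lintegral_id_prod (by fun_prop)]
  have h₁ : (P.map fun ω => ((A ω, B ω), f (B ω, C ω))) =
      (P.map fun ω => (A ω, B ω)) ⊗ₘ κ'.comap Prod.snd measurable_snd := by
    refine Measure.ext_of_lintegral _ fun g hg => ?_
    rw [Measure.lintegral_compProd hg]
    have e : (P.map fun ω => ((A ω, B ω), f (B ω, C ω))) =
        (P.map fun ω => ((A ω, B ω), C ω)).map (fun x => (x.1, f (x.1.2, x.2))) := by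
      rw [Measure.map_map (by fun_prop) (by fun_prop)]; rfl
    rw [e, hd.map_eq, lintegral_map hg (by fun_prop), Measure.lintegral_compProd (by fun_prop)]
    refine lintegral_congr fun x => ?_
    exact (hl x.2 (fun w => g (x, w)) (by fun_prop)).symm
  have h₂ : (P.map fun ω => (B ω, f (B ω, C ω))) = (P.map B) ⊗ₘ κ' :=
    (HasCondDistrib.comp_right (f := Prod.snd) (hf := measurable_snd)
      (Z := fun ω => (A ω, B ω)) ⟨by fun_prop, h₁⟩).map_eq
  have h₃ : (P.map fun ω => (B ω, f (B ω, C ω))) =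
      (P.map B) ⊗ₘ Kernel.const β (P.map fun ω => f (B ω, C ω)) := by
    rw [Measure.compProd_const]
    exact (indepFun_iff_map_prod_eq_prod_map_map hB.aemeasurable hW.aemeasurable).1 hi.symm
  -- Essential uniqueness of disintegrations: independence from `B` forces `κ'` to be almost
  -- everywhere constant, and `κ'` also governs the law given `(A, B)`.
  have hae := (condDistrib_ae_eq_of_measure_eq_compProd B hW.aemeasurable h₂).symm.trans
    (condDistrib_ae_eq_of_measure_eq_compProd B hW.aemeasurable h₃)
  have h₄ : (κ'.comap Prod.snd measurable_snd : Kernel (α × β) δ) =ᵐ[P.map fun ω => (A ω, B ω)]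
      Kernel.const (α × β) (P.map fun ω => f (B ω, C ω)) := by
    have e : P.map B = (P.map fun ω => (A ω, B ω)).map Prod.snd := by
      rw [Measure.map_map (by fun_prop) (by fun_prop)]; rfl
    rw [e] at hae
    filter_upwards [ae_of_ae_map (by fun_prop) hae] with x hx using by simpa using hx
  refine IndepFun.symm ((indepFun_iff_map_prod_eq_prod_map_map (by fun_prop)
    hW.aemeasurable).2 ?_)
  rw [h₁, Measure.compProd_congr h₄, Measure.compProd_const]

end Independence

/-! ### Gaussian linear regression. -/

section Regression

variable {Ω : Type*} [MeasurableSpace Ω] {P : Measure Ω}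

/-- The normal equations are solved by orthogonal projection in `L²` onto the span of the `g j`, so
the covariance matrix of the regressors may be singular. -/
lemma exists_integral_sub_sum_mul_eq_zero {ι : Type*} [Fintype ι] {f : Ω → ℝ} {g : ι → Ω → ℝ}
    (hf : MemLp f 2 P) (hg : ∀ j, MemLp (g j) 2 P) :
    ∃ d : ι → ℝ, ∀ k, ∫ ω, (f ω - ∑ j, d j * g j ω) * g k ω ∂P = 0 := by
  let v : ι → Lp ℝ 2 P := fun j => (hg j).toLp
  let K := Submodule.span ℝ (Set.range v)
  have : FiniteDimensional ℝ K := FiniteDimensional.span_of_finite ℝ (Set.finite_range v)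
  obtain ⟨d, hd⟩ := (Submodule.mem_span_range_iff_exists_fun ℝ).1
    (K.starProjection_apply_mem hf.toLp)
  refine ⟨d, fun k => ?_⟩
  have h := K.starProjection_inner_eq_zero hf.toLp (v k) (Submodule.subset_span ⟨k, rfl⟩)
  rw [← hd, L2.inner_def] at h
  rw [← h]
  refine integral_congr_ae ?_
  have hs : ((∑ j, d j • v j : Lp ℝ 2 P) : Ω → ℝ) =ᵐ[P] fun ω => ∑ j, d j * g j ω := by
    have h1 := Lp.coeFn_finsetSum Finset.univ fun j => d j • v j
    have h2 : ∀ᵐ ω ∂P, ∀ j, (d j • v j : Lp ℝ 2 P) ω = d j * g j ω := by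
      rw [ae_all_iff]
      intro j
      filter_upwards [Lp.coeFn_smul (d j) (v j), (hg j).coeFn_toLp] with ω h3 h4
      rw [h3, Pi.smul_apply, h4, smul_eq_mul]
    filter_upwards [h1, h2] with ω h1 h2
    rw [h1, Finset.sum_apply]
    exact Finset.sum_congr rfl fun j _ => h2 j
  filter_upwards [Lp.coeFn_sub hf.toLp (∑ j, d j • v j), hf.coeFn_toLp, (hg k).coeFn_toLp, hs]
    with ω h1 h2 h3 h4
  rw [h1, Pi.sub_apply, h2, h4]
  simp only [v, h3]
  simp [mul_comm]

/-- Linear regression of a jointly Gaussian pair: the residual is independent of the regressor. -/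
lemma exists_indepFun_sub_map {m n : ℕ} {X : Ω → Vec m} {S : Ω → Vec n}
    (h : HasGaussianLaw (fun ω => (X ω, S ω)) P) (hS : ∫ ω, S ω ∂P = 0) :
    ∃ D : Vec n →L[ℝ] Vec m, IndepFun (fun ω => X ω - D (S ω)) S P := by
  have := h.isProbabilityMeasure
  have hXi : ∀ i, MemLp (fun ω => X ω i) 2 P := fun i =>
    (h.fst.map_fun (EuclideanSpace.proj i : Vec m →L[ℝ] ℝ)).memLp_two
  have hSj : ∀ j, MemLp (fun ω => S ω j) 2 P := fun j =>
    (h.snd.map_fun (EuclideanSpace.proj j : Vec n →L[ℝ] ℝ)).memLp_two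
  choose d hd using fun i => exists_integral_sub_sum_mul_eq_zero (hXi i) hSj
  let D : Vec n →L[ℝ] Vec m := LinearMap.toContinuousLinearMap (Matrix.toEuclideanLin (Matrix.of d))
  have hD : ∀ s i, D s i = ∑ j, d i j * s j := fun s i => by
    simp [D, Matrix.toLpLin_apply, Matrix.mulVec, dotProduct]
  refine ⟨D, ?_⟩
  have hg : HasGaussianLaw (fun ω => (X ω - D (S ω), S ω)) P :=
    h.map_fun ((ContinuousLinearMap.fst ℝ _ _ - D.comp (ContinuousLinearMap.snd ℝ _ _)).prod
      (ContinuousLinearMap.snd ℝ _ _))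
  have hg' : HasGaussianLaw (fun ω => (fun i => (X ω - D (S ω)) i, fun j => S ω j)) P :=
    hg.map_equiv_fun (ContinuousLinearEquiv.prodCongr (EuclideanSpace.equiv (Fin m) ℝ)
      (EuclideanSpace.equiv (Fin n) ℝ))
  -- For jointly Gaussian vectors uncorrelated means independent. As `S` is centred, each covariance
  -- is exactly an integral made zero by the normal equations.
  have hi := HasGaussianLaw.indepFun_of_covariance_eval (X := fun i ω => (X ω - D (S ω)) i)
    (Y := fun j ω => S ω j) hg' (fun i k => by
    have hW : MemLp (fun ω => (X ω - D (S ω)) i) 2 P :=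
      (hg.fst.map_fun (EuclideanSpace.proj i : Vec m →L[ℝ] ℝ)).memLp_two
    rw [covariance_eq_sub hW (hSj k)]
    have h0 : ∫ ω, S ω k ∂P = 0 := by
      have := (EuclideanSpace.proj k : Vec n →L[ℝ] ℝ).integral_comp_comm h.snd.integrable
      rw [hS] at this
      simpa using this
    rw [h0, mul_zero, sub_zero, ← hd i k]
    refine integral_congr_ae (Filter.Eventually.of_forall fun ω => ?_)
    simp [hD])
  exact hi.comp (WithLp.measurable_toLp 2 _) (WithLp.measurable_toLp 2 _)

end Regression

/-! ### The rate comparison for a single user. -/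

section Decoupling

/-- Replacing the interference `S` by its image `E S`, and the signal `W` by `B W`, can be
compensated by a new linear assignment, if the output depends on `B W + E S` and noise only.
Here `K` is a regression matrix of `S` on `E S`. -/
lemma exists_mutualInfo_assignment_le {m k j : ℕ} {Ω δ ε : Type*} [MeasurableSpace Ω]
    [MeasurableSpace δ] [MeasurableSpace ε] [StandardBorelSpace ε] [Nonempty ε]
    {P : Measure Ω} [IsProbabilityMeasure P] {W : Ω → Vec m} {S : Ω → Vec k} {n : Ω → δ}
    (hW : Measurable W) (hS : Measurable S) (hn : Measurable n)
    (G : Vec k →L[ℝ] Vec m) (B : Vec m →L[ℝ] Vec j) (E : Vec k →L[ℝ] Vec j)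
    (K : Vec j →L[ℝ] Vec k) {g : Vec j × δ → ε} (hg : Measurable g)
    (hq : IndepFun (fun ω => S ω - K (E (S ω))) (fun ω => ((W ω, E (S ω)), n ω)) P)
    (hind : IndepFun (fun ω => (W ω, E (S ω))) n P) :
    ∃ e : ℝ≥0∞,
      mutualInfo P (fun ω => G (S ω) + W ω) (fun ω => g (B (W ω) + E (S ω), n ω)) ≤
        mutualInfo P (fun ω => B (G (K (E (S ω)))) + B (W ω))
          (fun ω => g (B (W ω) + E (S ω), n ω)) + e ∧
      mutualInfo P (fun ω => B (G (K (E (S ω)))) + B (W ω)) (fun ω => E (S ω)) + e ≤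
        mutualInfo P (fun ω => G (S ω) + W ω) S := by
  set q : Ω → Vec k := fun ω => S ω - K (E (S ω)) with hq_def
  set s : Ω → Vec j := fun ω => E (S ω) with hs_def
  set V : Ω → ε := fun ω => g (B (W ω) + E (S ω), n ω) with hV_def
  set U : Ω → Vec m := fun ω => G (S ω) + W ω with hU_def
  set U₁ : Ω → Vec m := fun ω => G (K (E (S ω))) + W ω with hU₁_def
  have mq : Measurable q := by fun_prop
  have ms : Measurable s := by fun_prop
  have mV : Measurable V := by fun_prop
  have mU : Measurable U := by fun_prop
  have mU₁ : Measurable U₁ := by fun_prop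
  have hqV : IndepFun q (fun ω => (U₁ ω, V ω)) P :=
    hq.comp (ψ := fun x : (Vec m × Vec j) × δ =>
      (G (K x.1.2) + x.1.1, g (B x.1.1 + x.1.2, x.2))) measurable_id (by fun_prop)
  have hqs : IndepFun q s P :=
    hq.comp (ψ := fun x : (Vec m × Vec j) × δ => x.1.2) measurable_id (by fun_prop)
  have hUs : IndepFun (fun ω => (U₁ ω, s ω)) n P :=
    hind.comp (φ := fun x : Vec m × Vec j => (G (K x.2) + x.1, x.2)) (by fun_prop) measurable_id
  -- The output is recovered from `B U₁`, `s` and `n` through `B W = B U₁ - B G K s`.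
  obtain ⟨d, hd₁, hd₂⟩ := exists_mutualInfo_le_add (P := P) (b := B)
    (g := fun x : (Vec j × Vec j) × δ => g (x.1.1 - B (G (K x.1.2)) + x.1.2, x.2))
    mU₁ ms hn B.continuous.measurable (by fun_prop) hUs
  have eV : (fun ω => g (B (U₁ ω) - B (G (K (s ω))) + s ω, n ω)) = V := by
    funext ω
    simp only [hU₁_def, hs_def, hV_def, map_add]
    congr 2
    abel
  have eU : (fun ω => B (U₁ ω)) = fun ω => B (G (K (s ω))) + B (W ω) := by
    funext ω
    simp only [hU₁_def, hs_def, map_add]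
  simp only [eV, eU] at hd₁ hd₂
  have eU₁ : U₁ = fun ω => U ω - G (q ω) := by
    funext ω
    simp only [hU₁_def, hU_def, hq_def, map_sub]
    abel
  -- One part of the slack comes from discarding `q`, the other from compressing `U₁` to `B U₁`.
  refine ⟨mutualInfo P U q + d, ?_, ?_⟩
  · calc mutualInfo P U V
        ≤ mutualInfo P U (fun ω => (q ω, V ω)) :=
          mutualInfo_comp_le (f := id) (g := Prod.snd) mU (by fun_prop) measurable_id
            measurable_snd
      _ = mutualInfo P U q + mutualInfo P (fun ω => (U ω, q ω)) V :=
          mutualInfo_prodMk_of_indepFun mU mq mV (hqV.comp measurable_id measurable_snd)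
      _ ≤ mutualInfo P U q + mutualInfo P (fun ω => (U₁ ω, q ω)) V := by
          gcongr
          have h := mutualInfo_comp_le (P := P) (A := fun ω => (U₁ ω, q ω)) (B := V)
            (f := fun x : Vec m × Vec k => (x.1 + G x.2, x.2)) (g := id)
            (by fun_prop) mV (by fun_prop) measurable_id
          simpa [eU₁] using h
      _ ≤ mutualInfo P U q + mutualInfo P U₁ V := by
          gcongr
          exact mutualInfo_prodMk_le_of_indepFun mU₁ mq mV hqV
      _ ≤ _ := by
          rw [add_comm (mutualInfo P U q) d, ← add_assoc, add_comm]
          gcongr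
  · calc mutualInfo P (fun ω => B (G (K (s ω))) + B (W ω)) s + (mutualInfo P U q + d)
        = mutualInfo P U q + mutualInfo P U₁ s := by rw [← hd₂]; ring
      _ ≤ mutualInfo P U q + mutualInfo P (fun ω => (U ω, q ω)) s := by
          gcongr
          have h := mutualInfo_comp_le (P := P) (A := fun ω => (U ω, q ω)) (B := s)
            (f := fun x : Vec m × Vec k => x.1 - G x.2) (g := id)
            (by fun_prop) ms (by fun_prop) measurable_id
          simpa [eU₁] using h
      _ = mutualInfo P U (fun ω => (q ω, s ω)) :=
          (mutualInfo_prodMk_of_indepFun mU mq ms hqs).symm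
      _ ≤ mutualInfo P U S :=
          mutualInfo_comp_le (f := id) (g := fun x => (x - K (E x), E x)) mU hS measurable_id
            (by fun_prop)

end Decoupling

/-! ### Partial sums and their linear transformation. -/

section PartialSums

variable {L M : ℕ} {Ω : Type*}

/-- Products `A_{n-1} ⋯ A_k` of endomorphisms, given through their recursion. -/
lemma exists_tail_products {E : Type*} [Monoid E] (A : ℕ → E) (n : ℕ) :
    ∃ B : ℕ → E, B n = 1 ∧ ∀ k < n, B k = B (k + 1) * A k := by
  induction n with
  | zero => exact ⟨fun _ => 1, rfl, fun k hk => absurd hk (Nat.not_lt_zero k)⟩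
  | succ n ih =>
    obtain ⟨B, hn, hB⟩ := ih
    refine ⟨fun k => if k ≤ n then A n * B k else 1, by simp, fun k hk => ?_⟩
    rcases Nat.lt_succ_iff_lt_or_eq.1 hk with h | rfl
    · simp [h.le, Nat.succ_le_of_lt h, hB k h, mul_assoc]
    · simp [hn]

lemma interference_eq_sum (π : Equiv.Perm (Fin L)) (X : Fin L → Ω → Vec M) (l : Fin L) (ω : Ω) :
    interference π X l ω = ∑ i with (π i : ℕ) < π l, X i ω := by
  rw [interference, Finset.sum_subtype (p := fun i => π i < π l) _ (by simp)]

lemma sum_filter_lt_succ (π : Equiv.Perm (Fin L)) {E : Type*} [AddCommMonoid E] (x : Fin L → E)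
    (l : Fin L) :
    ∑ i with (π i : ℕ) < (π l : ℕ) + 1, x i = ∑ i with (π i : ℕ) < π l, x i + x l := by
  have h : (Finset.univ.filter fun i => (π i : ℕ) < (π l : ℕ) + 1) =
      insert l (Finset.univ.filter fun i => (π i : ℕ) < π l) := by
    ext i
    simp only [Finset.mem_filter, Finset.mem_univ, true_and, Finset.mem_insert]
    rw [Nat.lt_succ_iff_lt_or_eq, or_comm, ← Fin.ext_iff, π.injective.eq_iff]
  rw [h, Finset.sum_insert (by simp), add_comm]

/-- The residuals of the signals after regression on their interferences can be transformed so that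
every partial sum is a linear image of the original one, and the total sum is the same. -/
lemma exists_transform_sum_eq (π : Equiv.Perm (Fin L)) {E : Type*} [NormedAddCommGroup E]
    [NormedSpace ℝ E] (D : Fin L → E →L[ℝ] E) :
    ∃ B : ℕ → E →L[ℝ] E, B L = 1 ∧ ∀ x : Fin L → E, ∀ k ≤ L,
      ∑ i with (π i : ℕ) < k, B (π i + 1) (x i - D i (∑ j with (π j : ℕ) < π i, x j)) =
        B k (∑ i with (π i : ℕ) < k, x i) := by
  -- The factor at position `k` is how `S_k` enters `S_{k+1} = (1 + D) S_k + R`; the default `1`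
  -- past the last position plays no role.
  obtain ⟨B, hL, hB⟩ := exists_tail_products
    (fun k => if h : k < L then 1 + D (π.symm ⟨k, h⟩) else 1) L
  refine ⟨B, hL, fun x k hk => ?_⟩
  induction k with
  | zero => simp
  | succ k ih =>
    obtain ⟨l, hl⟩ : ∃ l, (π l : ℕ) = k := ⟨π.symm ⟨k, hk⟩, by simp⟩
    have hBk := hB k hk
    subst hl
    rw [dif_pos (Nat.lt_of_succ_le hk), Fin.eta, Equiv.symm_apply_apply] at hBk
    rw [sum_filter_lt_succ, sum_filter_lt_succ, ih (Nat.le_of_lt hk), hBk]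
    generalize (∑ j with (π j : ℕ) < π l, x j) = s
    simp only [mul_apply_eq_comp, add_apply, one_apply_eq_self, map_add, map_sub]
    abel

lemma total_eq_sum_filter (π : Equiv.Perm (Fin L)) (X : Fin L → Ω → Vec M) (ω : Ω) :
    total X ω = ∑ i with (π i : ℕ) < L, X i ω := by
  rw [total, Finset.filter_true_of_mem fun i _ => (π i).isLt]

lemma total_eq_add (π : Equiv.Perm (Fin L)) (X : Fin L → Ω → Vec M) (l : Fin L) (ω : Ω) :
    total X ω = X l ω + interference π X l ω + ∑ i with π l < π i, X i ω := by
  rw [total, interference_eq_sum, add_comm (X l ω), ← sum_filter_lt_succ,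
    ← Finset.sum_filter_add_sum_filter_not Finset.univ (fun i => (π i : ℕ) < (π l : ℕ) + 1)]
  congr 1
  refine Finset.sum_congr (Finset.filter_congr fun i _ => ?_) fun _ _ => rfl
  rw [not_lt, Nat.succ_le_iff, Fin.lt_def]

end PartialSums

/-! ### Gaussian assignments. -/

section Assignment

variable {L M : ℕ} {Ω : Type*} [MeasurableSpace Ω] {P : Measure Ω}

lemma measurable_interference {π : Equiv.Perm (Fin L)} {X : Fin L → Ω → Vec M}
    (hX : ∀ l, Measurable (X l)) (l : Fin L) : Measurable (interference π X l) := by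
  unfold interference
  exact Finset.measurable_fun_sum _ fun i _ => hX i

lemma IsGaussianAssignment.integrable_interference {π : Equiv.Perm (Fin L)}
    {X : Fin L → Ω → Vec M} (h : IsGaussianAssignment π P X) (l : Fin L) :
    Integrable (interference π X l) P :=
  integrable_finsetSum _ fun i _ => (h.gaussian.eval (i : Fin L)).integrable

lemma IsGaussianAssignment.integral_interference {π : Equiv.Perm (Fin L)} {X : Fin L → Ω → Vec M}
    (h : IsGaussianAssignment π P X) (l : Fin L) : ∫ ω, interference π X l ω ∂P = 0 := by
  unfold interference
  rw [integral_finsetSum (f := fun (i : {i // π i < π l}) ω => X i ω) _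
    fun i _ => (h.gaussian.eval i).integrable]
  simp [h.zero_mean]

variable [IsProbabilityMeasure P]

/-- An assignment with independent signals fulfils the Markov relations. -/
lemma isGaussianAssignment_of_iIndepFun (π : Equiv.Perm (Fin L)) {X : Fin L → Ω → Vec M}
    (hX : ∀ l, Measurable (X l)) (hG : HasGaussianLaw (fun ω l => X l ω) P)
    (h0 : ∀ l, ∫ ω, X l ω ∂P = 0) (hi : iIndepFun X P) :
    IsGaussianAssignment π P X ∧ ∀ l, IndepFun (X l) (interference π X l) P := by
  have key : ∀ l, IndepFun (X l) (fun ω (i : {i // π i < π l}) => X i ω) P := fun l => by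
    have h := hi.indepFun_finset {l} (Finset.univ.filter fun i => π i < π l)
      (by simp) hX
    exact h.comp (φ := fun x : ({l} : Finset (Fin L)) → Vec M => x ⟨l, by simp⟩)
      (ψ := fun (x : (Finset.univ.filter fun i => π i < π l) → Vec M) (i : {i // π i < π l}) =>
        x ⟨i, by simp [i.2]⟩) (by fun_prop) (by fun_prop)
  refine ⟨⟨hX, hG, h0, fun l => ?_⟩, fun l => ?_⟩
  · refine isMarkovChain_of_indepFun (by fun_prop) (measurable_interference hX l) (hX l) ?_
    exact ((key l).comp (ψ := fun x : {i // π i < π l} → Vec M => (x, ∑ i, x i)) measurable_id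
      (by fun_prop)).symm
  · exact (key l).comp (ψ := fun x : {i // π i < π l} → Vec M => ∑ i, x i) measurable_id
      (by fun_prop)

/-- Each signal of a Gaussian assignment is a linear function of its interference, plus a residual
that is independent of all the earlier signals. -/
lemma IsGaussianAssignment.exists_residual {π : Equiv.Perm (Fin L)} {X : Fin L → Ω → Vec M}
    (h : IsGaussianAssignment π P X) (l : Fin L) :
    ∃ D : Vec M →L[ℝ] Vec M, IndepFun (fun ω => X l ω - D (interference π X l ω))
      (fun ω (i : {i // π i < π l}) => X i ω) P := by
  have hS := measurable_interference (π := π) h.measurable l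
  have hg : HasGaussianLaw (fun ω => (X l ω, interference π X l ω)) P := by
    have := h.gaussian.map_fun ((ContinuousLinearMap.proj (R := ℝ) (φ := fun _ => Vec M) l).prod
      (∑ i : {i // π i < π l},
        ContinuousLinearMap.proj (R := ℝ) (φ := fun _ => Vec M) (i : Fin L)))
    simpa [interference] using! this
  obtain ⟨D, hD⟩ := exists_indepFun_sub_map hg (h.integral_interference l)
  refine ⟨D, ?_⟩
  -- Regression gives independence from the sum `S_l` only; the Markov relation extends it to every
  -- earlier signal.
  have := (h.markov l).indepFun (by have := h.measurable; fun_prop) hS (h.measurable l)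
    (f := fun x => x.2 - D x.1) (by fun_prop) hD
  exact this.comp measurable_id measurable_fst

end Assignment

/-! ### Joint independence of the residuals. -/

section Residuals

variable {L M : ℕ} {Ω : Type*}

/-- The interference, as a linear function of the tuple of signals. -/
noncomputable def interferenceCLM (M : ℕ) (π : Equiv.Perm (Fin L)) (l : Fin L) :
    (Fin L → Vec M) →L[ℝ] Vec M :=
  ∑ i : {i // π i < π l}, ContinuousLinearMap.proj (i : Fin L)

lemma interferenceCLM_apply (π : Equiv.Perm (Fin L)) (X : Fin L → Ω → Vec M) (l : Fin L) (ω : Ω) :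
    interferenceCLM M π l (fun i => X i ω) = interference π X l ω := by
  simp [interferenceCLM, interference]

/-- The part of the signal `X l` that is not explained linearly by its interference. -/
noncomputable def residual (π : Equiv.Perm (Fin L)) (X : Fin L → Ω → Vec M)
    (D : Fin L → Vec M →L[ℝ] Vec M) (l : Fin L) (ω : Ω) : Vec M :=
  X l ω - D l (interference π X l ω)

lemma residual_eq_clm (π : Equiv.Perm (Fin L)) (X : Fin L → Ω → Vec M)
    (D : Fin L → Vec M →L[ℝ] Vec M) (l : Fin L) (ω : Ω) :
    residual π X D l ω = (ContinuousLinearMap.proj (R := ℝ) (φ := fun _ => Vec M) l -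
      (D l).comp (interferenceCLM M π l)) (fun i => X i ω) := by
  simp [residual, interferenceCLM_apply]

variable [MeasurableSpace Ω] {P : Measure Ω} {π : Equiv.Perm (Fin L)} {X : Fin L → Ω → Vec M}
  {D : Fin L → Vec M →L[ℝ] Vec M}

lemma measurable_residual (hX : ∀ l, Measurable (X l)) (l : Fin L) :
    Measurable (residual π X D l) := by
  have := measurable_interference (π := π) hX l
  have := hX l
  unfold residual
  fun_prop

lemma hasGaussianLaw_residual (h : IsGaussianAssignment π P X) :
    HasGaussianLaw (fun ω l => residual π X D l ω) P := by
  have := h.gaussian.map_fun (ContinuousLinearMap.pi fun l =>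
    ContinuousLinearMap.proj (R := ℝ) (φ := fun _ => Vec M) l -
      (D l).comp (interferenceCLM M π l))
  refine this.congr (Filter.Eventually.of_forall fun ω => ?_)
  funext l
  exact (residual_eq_clm π X D l ω).symm

lemma integral_residual (h : IsGaussianAssignment π P X) (l : Fin L) :
    ∫ ω, residual π X D l ω ∂P = 0 := by
  have := h.gaussian.isProbabilityMeasure
  have hS := h.integrable_interference l
  unfold residual
  rw [integral_sub (h.gaussian.eval l).integrable ((D l).integrable_comp hS),
    (D l).integral_comp_comm hS, h.integral_interference, h.zero_mean]
  simp

/-- The residuals are independent of each other, as each is independent of the earlier signals. -/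
lemma iIndepFun_residual (h : IsGaussianAssignment π P X)
    (hD : ∀ l, IndepFun (residual π X D l) (fun ω (i : {i // π i < π l}) => X i ω) P) :
    iIndepFun (residual π X D) P := by
  have hW := hasGaussianLaw_residual (D := D) h
  have key : ∀ i j, π i < π j → IndepFun (residual π X D j) (residual π X D i) P := fun i j hij =>
    (hD j).comp (φ := id) (ψ := fun x : {k // π k < π j} → Vec M =>
      x ⟨i, hij⟩ - D i (∑ k : {k // π k < π i}, x ⟨k, k.2.trans hij⟩)) measurable_id (by fun_prop)
  have hcov : ∀ i j, π i < π j → ∀ L₁ L₂ : StrongDual ℝ (Vec M),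
      cov[L₁ ∘ residual π X D j, L₂ ∘ residual π X D i; P] = 0 := fun i j hij L₁ L₂ =>
    ((key i j hij).comp L₁.continuous.measurable L₂.continuous.measurable).covariance_eq_zero
      ((hW.eval j).map L₁).memLp_two ((hW.eval i).map L₂).memLp_two
  -- Joint Gaussianity reduces mutual independence to pairwise vanishing covariances.
  refine hW.iIndepFun_of_covariance_strongDual fun i j hij L₁ L₂ => ?_
  rcases lt_or_gt_of_ne (π.injective.ne hij) with hlt | hlt
  · rw [covariance_comm]
    exact hcov i j hlt L₂ L₁
  · exact hcov j i hlt L₁ L₂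

/-- The residual and the interference of a user are independent of linear combinations of the later
residuals. -/
lemma indepFun_residual_sum (h : IsGaussianAssignment π P X)
    (hD : ∀ l, IndepFun (residual π X D l) (fun ω (i : {i // π i < π l}) => X i ω) P)
    (B : Fin L → Vec M →L[ℝ] Vec M) (l : Fin L) :
    IndepFun (fun ω => (residual π X D l ω, interference π X l ω))
      (fun ω => ∑ i with π l < π i, B i (residual π X D i ω)) P := by
  have := h.gaussian.isProbabilityMeasure
  let R : Fin L → (Fin L → Vec M) →L[ℝ] Vec M := fun l =>
    ContinuousLinearMap.proj (R := ℝ) (φ := fun _ => Vec M) l - (D l).comp (interferenceCLM M π l)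
  have hR : ∀ l ω, residual π X D l ω = R l (fun i => X i ω) := residual_eq_clm π X D
  have hS : ∀ ω, interference π X l ω = interferenceCLM M π l (fun i => X i ω) := fun ω =>
    (interferenceCLM_apply π X l ω).symm
  have hg : HasGaussianLaw (fun ω => ((residual π X D l ω, interference π X l ω),
      ∑ i with π l < π i, B i (residual π X D i ω))) P := by
    have := h.gaussian.map_fun (((R l).prod (interferenceCLM M π l)).prod
      (∑ i with π l < π i, (B i).comp (R i)))
    refine this.congr (Filter.Eventually.of_forall fun ω => ?_)
    simp [hR, hS]
  have hW := hasGaussianLaw_residual (D := D) h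
  refine hg.indepFun_of_covariance_strongDual fun L₁ L₂ => ?_
  have e : L₂ ∘ (fun ω => ∑ i with π l < π i, B i (residual π X D i ω)) =
      fun ω => ∑ i with π l < π i, (L₂.comp (B i)) (residual π X D i ω) := by
    funext ω
    simp
  have hm : ∀ i, MemLp (fun ω => (L₂.comp (B i)) (residual π X D i ω)) 2 P := fun i =>
    ((hW.eval i).map_fun _).memLp_two
  rw [e, covariance_fun_sum_right' (fun i _ => hm i) (hg.fst.map L₁).memLp_two]
  refine Finset.sum_eq_zero fun i hi => ?_
  have hli : π l < π i := by simpa using hi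
  have hind : IndepFun (residual π X D i)
      (fun ω => (residual π X D l ω, interference π X l ω)) P :=
    (hD i).comp (φ := id) (ψ := fun x : {k // π k < π i} → Vec M =>
      (x ⟨l, hli⟩ - D l (∑ k : {k // π k < π l}, x ⟨k, k.2.trans hli⟩),
        ∑ k : {k // π k < π l}, x ⟨k, k.2.trans hli⟩)) measurable_id (by fun_prop)
  rw [covariance_comm]
  exact (hind.comp (L₂.comp (B i)).continuous.measurable
    L₁.continuous.measurable).covariance_eq_zero (hm i) (hg.fst.map L₁).memLp_two

end Residuals

/-! ### Channel output and channel state. -/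

namespace Channel

variable {L M : ℕ} {N : Fin L → ℕ} (W : Channel L M N) {Ω : Type*} [MeasurableSpace Ω]
  {P : Measure Ω}

instance (l : Fin L) : IsProbabilityMeasure (W.fade l) := W.isProbabilityMeasure_fade l

instance [IsProbabilityMeasure P] : IsProbabilityMeasure (W.joint P) := by
  unfold joint
  infer_instance

lemma map_fst_joint : (W.joint P).map Prod.fst = P := by
  simp [joint]

/-- The channel output of user `l`, as a function of two parts of the transmitted signal and of the
channel state. -/
noncomputable def outputOf (N : Fin L → ℕ) (l : Fin L)
    (x : Vec M × Vec M × (∀ l, Matrix (Fin (N l)) (Fin M) ℝ) × (∀ l, Vec (N l))) :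
    Vec (N l) × Matrix (Fin (N l)) (Fin M) ℝ :=
  ((x.2.2.1 l).toEuclideanLin (x.1 + x.2.1) + x.2.2.2 l, x.2.2.1 l)

lemma measurable_toEuclideanLin_apply {m n : ℕ} :
    Measurable fun x : Matrix (Fin m) (Fin n) ℝ × Vec n => Matrix.toEuclideanLin x.1 x.2 := by
  have hc : ∀ i j, Measurable fun x : Matrix (Fin m) (Fin n) ℝ × Vec n => x.1 i j := fun i j =>
    ((measurable_pi_apply j).comp (measurable_pi_apply (X := fun _ => Fin n → ℝ) i)).comp
      measurable_fst
  have hm : Measurable fun x : Matrix (Fin m) (Fin n) ℝ × Vec n =>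
      (fun i => ∑ j, x.1 i j * x.2 j : Fin m → ℝ) :=
    measurable_pi_lambda _ fun i => Finset.measurable_fun_sum _ fun j _ =>
      (hc i j).mul (by fun_prop)
  exact (WithLp.measurable_toLp 2 _).comp hm

lemma measurable_outputOf (N : Fin L → ℕ) (l : Fin L) : Measurable (outputOf (M := M) N l) := by
  have hH : Measurable fun x : Vec M × Vec M × (∀ l, Matrix (Fin (N l)) (Fin M) ℝ) ×
      (∀ l, Vec (N l)) => x.2.2.1 l :=
    (measurable_pi_apply l).comp (measurable_fst.comp (measurable_snd.comp measurable_snd))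
  have hZ : Measurable fun x : Vec M × Vec M × (∀ l, Matrix (Fin (N l)) (Fin M) ℝ) ×
      (∀ l, Vec (N l)) => x.2.2.2 l :=
    (measurable_pi_apply l).comp (measurable_snd.comp (measurable_snd.comp measurable_snd))
  have hX : Measurable fun x : Vec M × Vec M × (∀ l, Matrix (Fin (N l)) (Fin M) ℝ) ×
      (∀ l, Vec (N l)) => x.1 + x.2.1 := measurable_fst.add (measurable_fst.comp measurable_snd)
  have hY := (measurable_toEuclideanLin_apply (m := N l) (n := M)).comp (hH.prodMk hX)
  exact (hY.add hZ).prodMk hH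

/-- Independent variables of the signals remain independent when the channel state, which is
independent of the signals, is adjoined to one of them. -/
lemma indepFun_joint [IsProbabilityMeasure P] {α β : Type*} [MeasurableSpace α] [MeasurableSpace β] {A : Ω → α} {T : Ω → β}
    (hA : Measurable A) (hT : Measurable T) (h : IndepFun A T P) :
    IndepFun (fun w : UseSpace N M Ω => A w.1) (fun w => (T w.1, w.2)) (W.joint P) := by
  refine indepFun_prodMk_right (by fun_prop) (by fun_prop) measurable_snd ?_ ?_
  · rw [indepFun_comp_iff_map measurable_fst hA hT, map_fst_joint]
    exact h
  · exact indepFun_prod (X := fun ω => (A ω, T ω)) (Y := id) (by fun_prop) measurable_id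

end Channel

/-! ### Construction of the independent assignment. -/

/-- Every Gaussian assignment can be replaced by one with independent signals, with the same total
signal and with rates that are at least as large. -/
theorem Channel.exists_independent_assignment {L M : ℕ} {N : Fin L → ℕ} (W : Channel L M N)
    {Ω : Type*} [MeasurableSpace Ω] {P : Measure Ω} [IsProbabilityMeasure P]
    {π : Equiv.Perm (Fin L)} {X : Fin L → Ω → Vec M} (F : Fin L → Matrix (Fin M) (Fin M) ℝ)
    (h : IsGaussianAssignment π P X) :
    ∃ (X' : Fin L → Ω → Vec M) (F' : Fin L → Matrix (Fin M) (Fin M) ℝ),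
      IsGaussianAssignment π P X' ∧ iIndepFun X' P ∧
      (∀ l, IndepFun (X' l) (interference π X' l) P) ∧ (∀ ω, total X' ω = total X ω) ∧
      ∀ l, W.rate P π X F l ≤ W.rate P π X' F' l := by
  choose D hD using h.exists_residual
  obtain ⟨B, hBL, hB⟩ := exists_transform_sum_eq π D
  set R := residual π X D with hR
  set X' : Fin L → Ω → Vec M := fun l ω => B (π l + 1) (R l ω) with hX'
  have mX := h.measurable
  have mS : ∀ l, Measurable (interference π X l) := measurable_interference mX
  have mR : ∀ l, Measurable (R l) := measurable_residual mX
  have hsum : ∀ ω, ∀ k ≤ L, ∑ i with (π i : ℕ) < k, X' i ω =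
      B k (∑ i with (π i : ℕ) < k, X i ω) := fun ω k hk => by
    rw [← hB (fun i => X i ω) k hk]
    simp only [hX', hR, residual, interference_eq_sum]
  have htot : ∀ ω, total X' ω = total X ω := fun ω => by
    rw [total_eq_sum_filter π, total_eq_sum_filter π, hsum ω L le_rfl, hBL]
    rfl
  have hint : ∀ l ω, interference π X' l ω = B (π l) (interference π X l ω) := fun l ω => by
    rw [interference_eq_sum, interference_eq_sum, hsum ω _ (π l).isLt.le]
  have hRG : HasGaussianLaw (fun ω l => R l ω) P := hasGaussianLaw_residual h
  have hi : iIndepFun X' P :=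
    (iIndepFun_residual h hD).comp (fun l => B (π l + 1)) fun l => (B _).continuous.measurable
  have hassign := isGaussianAssignment_of_iIndepFun π (X := X') (fun l => by fun_prop)
    (hRG.map_fun (ContinuousLinearMap.piMap fun l => B (π l + 1))) (fun l => by
      rw [(B _).integral_comp_comm (hRG.eval l).integrable, integral_residual h, map_zero]) hi
  -- `K l` stands in for an inverse of `B (π l)`, which need not exist.
  choose K hK using fun l => exists_indepFun_sub_map (P := P) (X := interference π X l)
    (S := fun ω => B (π l) (interference π X l ω))
    (by
      have := h.gaussian.map_fun ((interferenceCLM M π l).prod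
        ((B (π l)).comp (interferenceCLM M π l)))
      simpa [interferenceCLM_apply] using! this)
    (by
      rw [(B _).integral_comp_comm (h.integrable_interference l), h.integral_interference, map_zero])
  let G : Fin L → Vec M →L[ℝ] Vec M := fun l =>
    LinearMap.toContinuousLinearMap (Matrix.toEuclideanLin (F l)) + D l
  let F' : Fin L → Matrix (Fin M) (Fin M) ℝ := fun l =>
    Matrix.toEuclideanLin.symm ((B (π l + 1)).comp ((G l).comp (K l))).toLinearMap
  refine ⟨X', F', hassign.1, hi, hassign.2, htot, fun l => ?_⟩
  have hRS : IndepFun (R l) (interference π X l) P :=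
    (hD l).comp (ψ := fun x : {i // π i < π l} → Vec M => ∑ i, x i) measurable_id (by fun_prop)
  set T : Ω → Vec M := fun ω => ∑ i with π l < π i, X' i ω
  have mT : Measurable T := Finset.measurable_fun_sum _ fun i _ => by fun_prop
  have hT : IndepFun (fun ω => (R l ω, interference π X l ω)) T P :=
    indepFun_residual_sum h hD (fun i => B (π i + 1)) l
  have hqRs : IndepFun
      (fun ω => interference π X l ω - K l (B (π l) (interference π X l ω)))
      (fun ω => (R l ω, B (π l) (interference π X l ω))) P := by
    have mS := mS l
    have mR := mR l
    have := indepFun_prodMk_right (by fun_prop) (by fun_prop) mR (hK l)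
      (hRS.symm.comp (φ := fun x => (x - K l (B (π l) x), B (π l) x)) (by fun_prop) measurable_id)
    exact this.comp measurable_id measurable_swap
  have hqRsT : IndepFun
      (fun ω => interference π X l ω - K l (B (π l) (interference π X l ω)))
      (fun ω => ((R l ω, B (π l) (interference π X l ω)), T ω)) P := by
    have mS := mS l
    have mR := mR l
    exact indepFun_prodMk_right (by fun_prop) (by fun_prop) mT hqRs
      (hT.comp (φ := fun x : Vec M × Vec M =>
        (x.2 - K l (B (π l) x.2), (x.1, B (π l) x.2))) (by fun_prop) measurable_id)
  have mSl := mS l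
  have mRl := mR l
  have hq := W.indepFun_joint (by fun_prop) (by fun_prop) hqRsT
  -- The noise seen by user `l` consists of the later signals `T` together with all channel matrices
  -- and receiver noises.
  obtain ⟨e, he₁, he₂⟩ := exists_mutualInfo_assignment_le (P := W.joint P)
    (W := fun w => R l w.1) (S := fun w => interference π X l w.1) (n := fun w => (T w.1, w.2))
    (by fun_prop) (by fun_prop) (by fun_prop) (G l) (B (π l + 1)) (B (π l)) (K l)
    (Channel.measurable_outputOf N l)
    (hq.comp (ψ := fun x : ((Vec M × Vec M) × Vec M) × _ => (x.1.1, (x.1.2, x.2)))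
      measurable_id (by fun_prop))
    (W.indepFun_joint (by fun_prop) mT (hT.comp (φ := fun x : Vec M × Vec M => (x.1, B (π l) x.2))
      (by fun_prop) measurable_id))
  have eU : ∀ ω, aux π X F l ω = G l (interference π X l ω) + R l ω := fun ω => by
    simp only [aux, G, hR, residual, add_apply,
      LinearMap.coe_toContinuousLinearMap']
    abel
  have eU' : ∀ ω, aux π X' F' l ω =
      B (π l + 1) (G l (K l (B (π l) (interference π X l ω)))) + B (π l + 1) (R l ω) := fun ω => by
    rw [aux, hint]
    simp [F', hX']
  have eV : ∀ w : Channel.UseSpace N M Ω, Channel.output X l w =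
      Channel.outputOf N l (B (π l + 1) (R l w.1) + B (π l) (interference π X l w.1),
        (T w.1, w.2)) := fun w => by
    rw [Channel.output, ← htot, total_eq_add π X' l, hint]
    rfl
  have eV' : ∀ w : Channel.UseSpace N M Ω, Channel.output X' l w = Channel.output X l w :=
    fun w => by rw [Channel.output, Channel.output, htot]
  have mU : Measurable (aux π X F l) := by
    rw [funext eU]; fun_prop
  have mU' : Measurable (aux π X' F' l) := by
    rw [funext eU']; fun_prop
  have mS' : Measurable (interference π X' l) := by
    rw [funext (hint l)]; fun_prop
  simp only [← eV, ← eU, ← eU'] at he₁ he₂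
  simp only [← hint] at he₂
  -- The interference terms of the rates live on the signal space, the marginal of the joint law.
  rw [mutualInfo_map (T := Prod.fst) measurable_fst mU' mS',
    mutualInfo_map (T := Prod.fst) measurable_fst mU mSl, W.map_fst_joint] at he₂
  unfold Channel.rate
  rw [funext eV']
  exact ereal_sub_le_sub_of_add_le he₁ he₂

end FadingBC

theorem theorem2 (L M : ℕ) (N : Fin L → ℕ) (W : FadingBC.Channel L M N) :
    -- the LAFP region is exhausted by signals independent of their interferences
    (∀ p : ℝ, W.lafpRegion p = W.lafpRegionIndep p) ∧
    -- every assignment can be replaced by an independent one with the same transmitted signal,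
    -- without decreasing the rate of any user
    (∀ (Ω : Type*) [MeasurableSpace Ω] (P : Measure Ω) [IsProbabilityMeasure P]
      (π : Equiv.Perm (Fin L)) (X : Fin L → Ω → FadingBC.Vec M)
      (F : Fin L → Matrix (Fin M) (Fin M) ℝ),
      FadingBC.IsGaussianAssignment π P X →
      ∃ (X' : Fin L → Ω → FadingBC.Vec M) (F' : Fin L → Matrix (Fin M) (Fin M) ℝ),
        FadingBC.IsGaussianAssignment π P X' ∧
        iIndepFun X' P ∧
        (∀ l, IndepFun (X' l) (FadingBC.interference π X' l) P) ∧
        (∀ ω, FadingBC.total X' ω = FadingBC.total X ω) ∧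
        ∀ l, W.rate P π X F l ≤ W.rate P π X' F' l) := by
  refine ⟨fun p => Set.Subset.antisymm (convexHull_mono ?_) (convexHull_mono ?_), ?_⟩
  · rintro R ⟨Ω, _, P, _, π, X, F, hX, hp, hR⟩
    obtain ⟨X', F', hX', -, hind, htot, hrate⟩ := W.exists_independent_assignment F hX
    exact ⟨Ω, _, P, ‹_›, π, X', F', hX', hind, by simpa only [htot] using hp,
      fun l => ⟨(hR l).1, (hR l).2.trans (hrate l)⟩⟩
  · rintro R ⟨Ω, _, P, _, π, X, F, hX, -, hp, hR⟩
    exact ⟨Ω, _, P, ‹_›, π, X, F, hX, hp, hR⟩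
  · intro Ω _ P _ π X F hX
    exact W.exists_independent_assignment F hX
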